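/- **Proposition 1 (Additivity of linear uncertainty relations).** Let $\mathcal H_A,\mathcal H_B$ be finite-dimensional complex Hilbert spaces. A *state* is a positive semidefinite operator of trace one; a *projective measurement* is a finite family $X=\{X_i\}$ of mutually orthogonal projections with $\sum_i X_i=\mathbb 1$; and $H(X|\rho)=-\sum_i p_i\log p_i$ with $p_i=\operatorname{tr}(\rho X_i)$ and $0\log 0=0$ is the Shannon entropy (natural logarithm) of its outcome distribution in the state $\rho$. Let $X_A,Y_A$ be projective measurements on $\mathcal H_A$, let $X_B,Y_B$ be projective measurements on $\mathcal H_B$, and let $X_{AB}=\{X_{A,i}\otimes X_{B,j}\}_{i,j}$ and $Y_{AB}=\{Y_{A,k}\otimes Y_{B,l}\}_{k,l}$ be the joint measurements on $\mathcal H_A\otimes\mathcal H_B$. Fix weights $\lambda,\mu\ge 0$. 1. Suppose that the real numbers $c_A=c_A(\lambda,\mu)$ and $c_B=c_B(\lambda,\mu)$ satisfy $$\lambda H(X_A|\rho_A)+\mu H(Y_A|\rho_A)\ge c_A,\qquad \lambda H(X_B|\rho_B)+\mu H(Y_B|\rho_B)\ge c_B$$ for all states $\rho_A$ on $\mathcal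 H_A$ and $\rho_B$ on $\mathcal H_B$. Then $$\lambda H(X_{AB}|\rho_{AB})+\mu H(Y_{AB}|\rho_{AB})\ge c_A+c_B$$ for every state $\rho_{AB}$ on $\mathcal H_A\otimes\mathcal H_B$, entangled or not. 2. If $c_A$ and $c_B$ are optimal, i.e. each is the largest constant for which its inequality holds on all states, then $c_{AB}:=c_A+c_B$ is the largest constant for which $$\lambda H(X_{AB}|\rho_{AB})+\mu H(Y_{AB}|\rho_{AB})\ge c_{AB}$$ holds for all states $\rho_{AB}$, and equality is attained at some product state $\rho_A\otimes\rho_B$. -/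

import Mathlib

open scoped Kronecker ComplexOrder

/-- A quantum state on the finite-dimensional Hilbert space `ℂⁿ`: a positive semidefinite matrix
of trace one. -/
structure IsQuantumState {n : Type*} [Fintype n] (ρ : Matrix n n ℂ) : Prop where
  posSemidef : ρ.PosSemidef
  trace_eq_one : ρ.trace = 1

/-- A projective measurement with outcomes in `ι`: mutually orthogonal Hermitian projections that
sum to the identity. The projections may have any rank. -/
structure IsProjectiveMeasurement {ι n : Type*} [Fintype ι] [Fintype n] [DecidableEq n]
    (X : ι → Matrix n n ℂ) : Prop where
  isHermitian : ∀ i, (X i).IsHermitian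
  mul_self : ∀ i, X i * X i = X i
  orthogonal : ∀ i j, i ≠ j → X i * X j = 0
  sum_eq_one : ∑ i, X i = 1

/-- The joint measurement that arises from performing `X` on the first and `X'` on the second
subsystem; the outcomes are all pairs of local outcomes. -/
def productMeasurement {ι κ n m : Type*} (X : ι → Matrix n n ℂ) (X' : κ → Matrix m m ℂ) :
    ι × κ → Matrix (n × m) (n × m) ℂ :=
  fun k => X k.1 ⊗ₖ X' k.2

/-- The probability `tr (ρ Xᵢ)` of outcome `i` (a real number whenever `ρ` is a state and `X` is a
projective measurement). -/
noncomputable def outcomeProb {ι n : Type*} [Fintype n] (X : ι → Matrix n n ℂ)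
    (ρ : Matrix n n ℂ) (i : ι) : ℝ :=
  (ρ * X i).trace.re

/-- The Shannon entropy `H(X|ρ) = - ∑ᵢ pᵢ log pᵢ`, with the convention `0 log 0 = 0`. -/
noncomputable def measurementEntropy {ι n : Type*} [Fintype ι] [Fintype n]
    (X : ι → Matrix n n ℂ) (ρ : Matrix n n ℂ) : ℝ :=
  ∑ i, Real.negMulLog (outcomeProb X ρ i)

/-- The weighted entropy sum `lam * H(X|ρ) + mu * H(Y|ρ)`. -/
noncomputable def linearUncertainty {ι κ n : Type*} [Fintype ι] [Fintype κ] [Fintype n]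
    (lam mu : ℝ) (X : ι → Matrix n n ℂ) (Y : κ → Matrix n n ℂ) (ρ : Matrix n n ℂ) : ℝ :=
  lam * measurementEntropy X ρ + mu * measurementEntropy Y ρ

/-- `c` is a state-independent lower bound on the weighted entropy sum. -/
def IsUncertaintyBound {ι κ n : Type*} [Fintype ι] [Fintype κ] [Fintype n]
    (lam mu : ℝ) (X : ι → Matrix n n ℂ) (Y : κ → Matrix n n ℂ) (c : ℝ) : Prop :=
  ∀ ρ : Matrix n n ℂ, IsQuantumState ρ → c ≤ linearUncertainty lam mu X Y ρ

/-- `c` is the optimal, i.e. the largest, state-independent lower bound. -/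
def IsOptimalUncertaintyBound {ι κ n : Type*} [Fintype ι] [Fintype κ] [Fintype n]
    (lam mu : ℝ) (X : ι → Matrix n n ℂ) (Y : κ → Matrix n n ℂ) (c : ℝ) : Prop :=
  IsGreatest {c' : ℝ | IsUncertaintyBound lam mu X Y c'} c

/-! Condition each subsystem on a measurement of the other: A on the outcome of X_B, and B on the
outcome of Y_A. Averaging the local bounds over the conditional states gives c_A ≤ λ(H(X_A X_B) -
H(X_B)) + μ(H(Y_A X_B) - H(X_B)) and c_B ≤ λ(H(Y_A X_B) - H(Y_A)) + μ(H(Y_A Y_B) - H(Y_A)). In the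
sum, the terms beyond λ H(X_AB) + μ H(Y_AB) are (λ+μ)(H(Y_A X_B) - H(X_B) - H(Y_A)), which is at
most 0 by subadditivity of Shannon entropy (`sum_negMulLog_le_sum_marginals`). Entanglement plays no
role, because Y_A and X_B commute and so have a joint distribution. For optimality, compactness of
the state space yields local minimizers, and entropies add on their product. -/

open scoped Matrix

/-- Subadditivity of Shannon entropy: the entropy of a joint distribution is at most the sum of the
entropies of its marginals. -/
theorem sum_negMulLog_le_sum_marginals {ι κ : Type*} [Fintype ι] [Fintype κ] (w : ι → κ → ℝ)
    (hw : ∀ i j, 0 ≤ w i j) (hsum : ∑ i, ∑ j, w i j = 1) :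
    ∑ i, ∑ j, Real.negMulLog (w i j) ≤
      ∑ i, Real.negMulLog (∑ j, w i j) + ∑ j, Real.negMulLog (∑ i, w i j) := by
  set r : ι → ℝ := fun i => ∑ j, w i j with hr
  set s : κ → ℝ := fun j => ∑ i, w i j with hs
  have hr1 : ∑ i, r i = 1 := hsum
  have hs1 : ∑ j, s j = 1 := by rw [← hsum, Finset.sum_comm]
  -- This is `log x ≤ x - 1` at `x = r i * s j / w i j`, multiplied by `w i j`. The corrections `r i
  -- * s j - w i j` sum to `1 - 1 = 0`.
  have key : ∀ i j, Real.negMulLog (w i j) ≤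
      -(w i j * Real.log (r i)) - w i j * Real.log (s j) + r i * s j - w i j := by
    intro i j
    have hwr : w i j ≤ r i :=
      Finset.single_le_sum (f := fun j => w i j) (fun j _ => hw i j) (Finset.mem_univ j)
    have hws : w i j ≤ s j :=
      Finset.single_le_sum (f := fun i => w i j) (fun i _ => hw i j) (Finset.mem_univ i)
    rcases (hw i j).eq_or_lt with h0 | hpos
    · rw [← h0] at hwr hws ⊢
      simpa using mul_nonneg hwr hws
    · have hrp := hpos.trans_le hwr
      have hsp := hpos.trans_le hws
      have hlog := Real.log_le_sub_one_of_pos (div_pos (mul_pos hrp hsp) hpos)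
      rw [Real.log_div (mul_pos hrp hsp).ne' hpos.ne', Real.log_mul hrp.ne' hsp.ne'] at hlog
      have h := mul_le_mul_of_nonneg_left hlog hpos.le
      have hc : w i j * (r i * s j / w i j - 1) = r i * s j - w i j := by
        field_simp
      rw [hc] at h
      rw [Real.negMulLog]
      linarith
  have e1 : ∑ i, ∑ j, w i j * Real.log (r i) = -∑ i, Real.negMulLog (r i) := by
    rw [← Finset.sum_neg_distrib]
    refine Finset.sum_congr rfl fun i _ => ?_
    rw [← Finset.sum_mul, Real.negMulLog]
    ring
  have e2 : ∑ i, ∑ j, w i j * Real.log (s j) = -∑ j, Real.negMulLog (s j) := by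
    rw [Finset.sum_comm, ← Finset.sum_neg_distrib]
    refine Finset.sum_congr rfl fun j _ => ?_
    rw [← Finset.sum_mul, Real.negMulLog]
    ring
  have e3 : ∑ i, ∑ j, r i * s j = 1 := by
    rw [← Finset.sum_mul_sum, hr1, hs1, one_mul]
  have h := Finset.sum_le_sum fun i (_ : i ∈ Finset.univ) =>
    Finset.sum_le_sum fun j (_ : j ∈ Finset.univ) => key i j
  simp only [Finset.sum_sub_distrib, Finset.sum_add_distrib, Finset.sum_neg_distrib] at h
  rw [e1, e2, e3, hsum] at h
  linarith

/-- The expectation of a projection in an unnormalized state is a nonnegative real number. -/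
theorem Matrix.PosSemidef.trace_mul_projection_nonneg {n : Type*} [Fintype n] {R P : Matrix n n ℂ}
    (hR : R.PosSemidef) (hP : P.IsHermitian) (hPP : P * P = P) : 0 ≤ (R * P).trace := by
  have h := (hR.conjTranspose_mul_mul_same P).trace_nonneg
  rwa [hP.eq, Matrix.trace_mul_cycle, Matrix.trace_mul_comm, hPP] at h

theorem IsProjectiveMeasurement.outcomeProb_nonneg {ι n : Type*} [Fintype ι] [Fintype n]
    [DecidableEq n] {X : ι → Matrix n n ℂ} (hX : IsProjectiveMeasurement X) {R : Matrix n n ℂ}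
    (hR : R.PosSemidef) (i : ι) : 0 ≤ outcomeProb X R i :=
  (Complex.le_def.1 (hR.trace_mul_projection_nonneg (hX.isHermitian i) (hX.mul_self i))).1

/-- Taking the real part loses nothing here. This makes probabilities multiply on product states,
although `re` is not multiplicative. -/
theorem IsProjectiveMeasurement.ofReal_outcomeProb {ι n : Type*} [Fintype ι] [Fintype n]
    [DecidableEq n] {X : ι → Matrix n n ℂ} (hX : IsProjectiveMeasurement X) {R : Matrix n n ℂ}
    (hR : R.PosSemidef) (i : ι) : (outcomeProb X R i : ℂ) = (R * X i).trace := by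
  have h := Complex.le_def.1
    (hR.trace_mul_projection_nonneg (hX.isHermitian i) (hX.mul_self i))
  exact Complex.ext rfl h.2

theorem IsProjectiveMeasurement.sum_outcomeProb {ι n : Type*} [Fintype ι] [Fintype n]
    [DecidableEq n] {X : ι → Matrix n n ℂ} (hX : IsProjectiveMeasurement X) (R : Matrix n n ℂ) :
    ∑ i, outcomeProb X R i = R.trace.re := by
  simp only [outcomeProb]
  rw [← Complex.re_sum, ← Matrix.trace_sum, ← Finset.mul_sum, hX.sum_eq_one, mul_one]

theorem outcomeProb_smul {ι n : Type*} [Fintype n] (X : ι → Matrix n n ℂ) (t : ℝ)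
    (R : Matrix n n ℂ) (i : ι) : outcomeProb X ((t : ℂ) • R) i = t * outcomeProb X R i := by
  simp [outcomeProb, Matrix.trace_smul]

theorem measurementEntropy_smul {ι n : Type*} [Fintype ι] [Fintype n] [DecidableEq n]
    {X : ι → Matrix n n ℂ} (hX : IsProjectiveMeasurement X) (t : ℝ) (R : Matrix n n ℂ) :
    measurementEntropy X ((t : ℂ) • R) =
      R.trace.re * Real.negMulLog t + t * measurementEntropy X R := by
  simp only [measurementEntropy, outcomeProb_smul, Real.negMulLog_mul]
  rw [Finset.sum_add_distrib, ← Finset.sum_mul, ← Finset.mul_sum, hX.sum_outcomeProb]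

/-- The homogeneous form of an uncertainty relation, valid for unnormalized states. -/
theorem IsUncertaintyBound.trace_mul_le {ι κ n : Type*} [Fintype ι] [Fintype κ] [Fintype n]
    [DecidableEq n] {lam mu c : ℝ} {X : ι → Matrix n n ℂ} {Y : κ → Matrix n n ℂ}
    (hc : IsUncertaintyBound lam mu X Y c) (hX : IsProjectiveMeasurement X)
    (hY : IsProjectiveMeasurement Y) {R : Matrix n n ℂ} (hR : R.PosSemidef) :
    R.trace.re * c ≤ lam * (measurementEntropy X R - Real.negMulLog R.trace.re) +
      mu * (measurementEntropy Y R - Real.negMulLog R.trace.re) := by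
  obtain ⟨t, ht⟩ : ∃ t : ℝ, R.trace = t :=
    ⟨R.trace.re, Complex.ext rfl (Complex.le_def.1 hR.trace_nonneg).2.symm⟩
  have ht0 : 0 ≤ t := by simpa [ht] using hR.trace_nonneg
  rcases ht0.eq_or_lt with h0 | hpos
  · have hR0 : R = 0 := hR.trace_eq_zero_iff.1 (by rw [ht, ← h0, Complex.ofReal_zero])
    simp [hR0, measurementEntropy, outcomeProb]
  · set S : Matrix n n ℂ := ((t⁻¹ : ℝ) : ℂ) • R with hS
    have htC : (t : ℂ) ≠ 0 := Complex.ofReal_ne_zero.2 hpos.ne'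
    have hSS : IsQuantumState S :=
      ⟨hR.smul (by simpa using hpos.le), by simp [hS, Matrix.trace_smul, ht, htC]⟩
    have hRS : R = (t : ℂ) • S := by simp [hS, smul_smul, htC]
    -- By the scaling law, `t` times the entropy in `S` is the entropy in `R` minus `Real.negMulLog
    -- t`.
    have hb := mul_le_mul_of_nonneg_left (hc S hSS) hpos.le
    have eX := measurementEntropy_smul hX t S
    have eY := measurementEntropy_smul hY t S
    rw [← hRS, hSS.trace_eq_one] at eX eY
    rw [ht, eX, eY]
    simp only [linearUncertainty, Complex.one_re, Complex.ofReal_re] at hb ⊢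
    linarith

/-- The unnormalized conditional state of the first subsystem given that the projection `P` was
observed on the second one. -/
theorem Matrix.PosSemidef.exists_conditional_fst {a b : Type*} [Fintype a] [DecidableEq a]
    [Fintype b] {ρ : Matrix (a × b) (a × b) ℂ} (hρ : ρ.PosSemidef)
    {P : Matrix b b ℂ} (hP : P.IsHermitian) (hPP : P * P = P) :
    ∃ R : Matrix a a ℂ, R.PosSemidef ∧ ∀ M, (R * M).trace = (ρ * M ⊗ₖ P).trace := by
  classical
  set Q : Matrix (a × b) (a × b) ℂ := (1 : Matrix a a ℂ) ⊗ₖ P with hQ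
  have hQH : Qᴴ = Q := by rw [hQ, Matrix.conjTranspose_kronecker, hP.eq, Matrix.conjTranspose_one]
  -- Compress by `1 ⊗ P`, then trace out the second factor. The partial trace is a sum of principal
  -- submatrices, hence positive semidefinite.
  set S := Qᴴ * ρ * Q with hS
  refine ⟨∑ k, S.submatrix (fun i => (i, k)) (fun i => (i, k)),
    Matrix.posSemidef_sum _ fun k _ => (hρ.conjTranspose_mul_mul_same Q).submatrix _, fun M => ?_⟩
  have h1 : ((∑ k, S.submatrix (fun i => (i, k)) (fun i => (i, k))) * M).trace =
      (S * M ⊗ₖ (1 : Matrix b b ℂ)).trace := by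
    simp only [Matrix.trace, Matrix.diag, Matrix.mul_apply, Fintype.sum_prod_type,
      Matrix.kronecker_apply, Matrix.sum_apply, Matrix.submatrix_apply, Finset.sum_mul,
      Matrix.one_apply, mul_ite, mul_one, mul_zero, Finset.sum_ite_eq', Finset.mem_univ, if_true]
    exact Finset.sum_congr rfl fun i _ => Finset.sum_comm
  have h2 : Q * M ⊗ₖ (1 : Matrix b b ℂ) * Q = M ⊗ₖ P := by
    simp only [hQ, ← Matrix.mul_kronecker_mul, one_mul, mul_one, hPP]
  rw [h1, hS, hQH, Matrix.mul_assoc, Matrix.mul_assoc, Matrix.trace_mul_comm, Matrix.mul_assoc, h2]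

/-- The unnormalized conditional state of the second subsystem given that the projection `P` was
observed on the first one. -/
theorem Matrix.PosSemidef.exists_conditional_snd {a b : Type*} [Fintype a] [Fintype b]
    [DecidableEq b] {ρ : Matrix (a × b) (a × b) ℂ} (hρ : ρ.PosSemidef)
    {P : Matrix a a ℂ} (hP : P.IsHermitian) (hPP : P * P = P) :
    ∃ R : Matrix b b ℂ, R.PosSemidef ∧ ∀ M, (R * M).trace = (ρ * P ⊗ₖ M).trace := by
  obtain ⟨R, hR, h⟩ := (hρ.submatrix (Prod.swap : b × a → a × b)).exists_conditional_fst hP hPP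
  refine ⟨R, hR, fun M => (h M).trans ?_⟩
  have hM : M ⊗ₖ P = (P ⊗ₖ M).submatrix (Equiv.prodComm b a) (Equiv.prodComm b a) := by
    ext i j
    simp [mul_comm]
  rw [hM]
  exact (congrArg Matrix.trace
    (Matrix.submatrix_mul_equiv ρ (P ⊗ₖ M) (Equiv.prodComm b a) (Equiv.prodComm b a)
      (Equiv.prodComm b a))).trans
    (by simp [Matrix.trace, Matrix.diag, Fintype.sum_prod_type, Finset.sum_comm (γ := a)])

theorem IsProjectiveMeasurement.productMeasurement {ι κ n m : Type*} [Fintype ι] [Fintype κ]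
    [Fintype n] [DecidableEq n] [Fintype m] [DecidableEq m] {X : ι → Matrix n n ℂ}
    {X' : κ → Matrix m m ℂ} (hX : IsProjectiveMeasurement X) (hX' : IsProjectiveMeasurement X') :
    IsProjectiveMeasurement (productMeasurement X X') where
  isHermitian k := by
    rw [Matrix.IsHermitian, _root_.productMeasurement, Matrix.conjTranspose_kronecker,
      (hX.isHermitian _).eq, (hX'.isHermitian _).eq]
  mul_self k := by
    rw [_root_.productMeasurement, ← Matrix.mul_kronecker_mul, hX.mul_self, hX'.mul_self]
  orthogonal k l hkl := by
    simp only [_root_.productMeasurement, ← Matrix.mul_kronecker_mul]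
    by_cases h : k.1 = l.1
    · rw [hX'.orthogonal _ _ fun h' => hkl (Prod.ext h h'), Matrix.kronecker_zero]
    · rw [hX.orthogonal _ _ h, Matrix.zero_kronecker]
  sum_eq_one := by
    ext i j
    have h := congrArg₂ (fun A B : Matrix _ _ ℂ => (A ⊗ₖ B) i j) hX.sum_eq_one hX'.sum_eq_one
    simp only [Matrix.one_kronecker_one] at h
    rw [← h, Matrix.kronecker_apply, Matrix.sum_apply, Matrix.sum_apply, Matrix.sum_apply,
      Finset.sum_mul_sum, Fintype.sum_prod_type]
    rfl

/-- Linear uncertainty bounds add up under joint measurements. -/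
theorem IsUncertaintyBound.add_productMeasurement {a b ιA κA ιB κB : Type*}
    [Fintype a] [DecidableEq a] [Fintype b] [DecidableEq b]
    [Fintype ιA] [Fintype κA] [Fintype ιB] [Fintype κB]
    {XA : ιA → Matrix a a ℂ} {YA : κA → Matrix a a ℂ}
    {XB : ιB → Matrix b b ℂ} {YB : κB → Matrix b b ℂ}
    (hXA : IsProjectiveMeasurement XA) (hYA : IsProjectiveMeasurement YA)
    (hXB : IsProjectiveMeasurement XB) (hYB : IsProjectiveMeasurement YB)
    {lam mu : ℝ} (hlam : 0 ≤ lam) (hmu : 0 ≤ mu) {cA cB : ℝ}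
    (hA : IsUncertaintyBound lam mu XA YA cA) (hB : IsUncertaintyBound lam mu XB YB cB) :
    IsUncertaintyBound lam mu (productMeasurement XA XB) (productMeasurement YA YB)
      (cA + cB) := by
  intro ρ hρ
  -- The crossed choice, `XB` for `R` and `YA` for `T`, makes the same joint distribution `w` appear
  -- in both averaged bounds.
  choose R hR hRM using fun j =>
    hρ.posSemidef.exists_conditional_fst (hXB.isHermitian j) (hXB.mul_self j)
  choose T hT hTM using fun k =>
    hρ.posSemidef.exists_conditional_snd (hYA.isHermitian k) (hYA.mul_self k)
  -- the joint distribution of the commuting measurements `YA` and `XB`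
  set w : κA → ιB → ℝ := fun k j => outcomeProb (productMeasurement YA XB) ρ (k, j) with hw
  have hw0 : ∀ k j, 0 ≤ w k j := fun k j =>
    (hYA.productMeasurement hXB).outcomeProb_nonneg hρ.posSemidef (k, j)
  have hw1 : ∑ k, ∑ j, w k j = 1 := by
    rw [← Fintype.sum_prod_type', (hYA.productMeasurement hXB).sum_outcomeProb, hρ.trace_eq_one,
      Complex.one_re]
  have hRY : ∀ j k, outcomeProb YA (R j) k = w k j := fun j k =>
    congrArg Complex.re (hRM j (YA k))
  have hTX : ∀ k j, outcomeProb XB (T k) j = w k j := fun k j =>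
    congrArg Complex.re (hTM k (XB j))
  have hRX : ∀ j i, outcomeProb XA (R j) i =
      outcomeProb (productMeasurement XA XB) ρ (i, j) := fun j i =>
    congrArg Complex.re (hRM j (XA i))
  have hTY : ∀ k l, outcomeProb YB (T k) l =
      outcomeProb (productMeasurement YA YB) ρ (k, l) := fun k l =>
    congrArg Complex.re (hTM k (YB l))
  have hRt : ∀ j, (R j).trace.re = ∑ k, w k j := fun j => by
    simp only [← hYA.sum_outcomeProb, hRY]
  have hTt : ∀ k, (T k).trace.re = ∑ j, w k j := fun k => by
    simp only [← hXB.sum_outcomeProb, hTX]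
  have hsumA := Finset.sum_le_sum fun j (_ : j ∈ Finset.univ) => hA.trace_mul_le hXA hYA (hR j)
  have hsumB := Finset.sum_le_sum fun k (_ : k ∈ Finset.univ) => hB.trace_mul_le hXB hYB (hT k)
  have hw1' : ∑ j, ∑ k, w k j = 1 := by rw [Finset.sum_comm, hw1]
  have eX : ∑ j, measurementEntropy XA (R j) =
      measurementEntropy (productMeasurement XA XB) ρ := by
    simp only [measurementEntropy, hRX]
    rw [Finset.sum_comm, Fintype.sum_prod_type]
  have eY : ∑ k, measurementEntropy YB (T k) =
      measurementEntropy (productMeasurement YA YB) ρ := by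
    simp only [measurementEntropy, hTY]
    rw [Fintype.sum_prod_type]
  have eW : ∑ j, measurementEntropy YA (R j) = ∑ k, ∑ j, Real.negMulLog (w k j) := by
    simp only [measurementEntropy, hRY]
    rw [Finset.sum_comm]
  have eW' : ∑ k, measurementEntropy XB (T k) = ∑ k, ∑ j, Real.negMulLog (w k j) := by
    simp only [measurementEntropy, hTX]
  simp only [Finset.sum_add_distrib, ← Finset.mul_sum, Finset.sum_sub_distrib, ← Finset.sum_mul,
    hRt, hTt, hw1, hw1', one_mul, eX, eY, eW, eW'] at hsumA hsumB
  have hI := mul_le_mul_of_nonneg_left (sum_negMulLog_le_sum_marginals w hw0 hw1)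
    (add_nonneg hlam hmu)
  rw [linearUncertainty]
  linarith

/-- States are the matrices `Bᴴ * B` with `B` on the Frobenius unit sphere, so they form a
continuous image of a compact set. -/
theorem isCompact_setOf_isQuantumState (n : Type*) [Fintype n] :
    IsCompact {ρ : Matrix n n ℂ | IsQuantumState ρ} := by
  classical
  set K : Set (Matrix n n ℂ) := {B | (Bᴴ * B).trace = 1} with hK
  have hcont : Continuous fun B : Matrix n n ℂ => Bᴴ * B := by fun_prop
  have hclosed : IsClosed K := isClosed_eq hcont.matrix_trace continuous_const
  have hbox : IsCompact (Set.univ.pi fun _ : n => Set.univ.pi fun _ : n =>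
      Metric.closedBall (0 : ℂ) 1) :=
    isCompact_univ_pi fun _ => isCompact_univ_pi fun _ => isCompact_closedBall _ _
  have hsub : K ⊆ Set.univ.pi fun _ : n => Set.univ.pi fun _ : n =>
      Metric.closedBall (0 : ℂ) 1 := by
    intro B hB i _ j _
    have h : ∑ k, ∑ l, ‖B l k‖ ^ 2 = 1 := by
      have h' := congrArg Complex.re (show (Bᴴ * B).trace = 1 from hB)
      simpa [Matrix.trace, Matrix.mul_apply, ← Complex.normSq_eq_conj_mul_self,
        Complex.normSq_eq_norm_sq, ← Complex.ofReal_pow] using h'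
    have h1 : ∑ l, ‖B l j‖ ^ 2 ≤ 1 := h ▸
      Finset.single_le_sum (f := fun k => ∑ l, ‖B l k‖ ^ 2)
        (fun k _ => Finset.sum_nonneg fun l _ => sq_nonneg _) (Finset.mem_univ j)
    have h2 : ‖B i j‖ ^ 2 ≤ 1 :=
      (Finset.single_le_sum (f := fun l => ‖B l j‖ ^ 2) (fun l _ => sq_nonneg _)
        (Finset.mem_univ i)).trans h1
    rw [mem_closedBall_zero_iff]
    exact (sq_le_one_iff₀ (norm_nonneg _)).1 h2
  have himage : {ρ : Matrix n n ℂ | IsQuantumState ρ} = (fun B => Bᴴ * B) '' K := by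
    ext ρ
    constructor
    · intro hρ
      obtain ⟨B, hB⟩ : ∃ B : Matrix n n ℂ, ρ = Bᴴ * B := by
        open scoped MatrixOrder Matrix.Norms.L2Operator in
        exact CStarAlgebra.nonneg_iff_eq_star_mul_self.mp hρ.posSemidef.nonneg
      exact ⟨B, by rw [hK, Set.mem_ofPred_eq, ← hB, hρ.trace_eq_one], hB.symm⟩
    · rintro ⟨B, hB, rfl⟩
      exact ⟨Matrix.posSemidef_conjTranspose_mul_self B, hB⟩
  rw [himage]
  exact (hbox.of_isClosed_subset hclosed hsub).image hcont

theorem continuous_measurementEntropy {ι n : Type*} [Fintype ι] [Fintype n]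
    (X : ι → Matrix n n ℂ) : Continuous (measurementEntropy X) := by
  refine continuous_finsetSum _ fun i _ => Real.continuous_negMulLog.comp ?_
  exact Complex.continuous_re.comp (continuous_id.matrix_mul continuous_const).matrix_trace

/-- An optimal uncertainty bound is attained. -/
theorem IsOptimalUncertaintyBound.exists_eq {ι κ n : Type*} [Fintype ι] [Fintype κ] [Fintype n]
    {lam mu c : ℝ} {X : ι → Matrix n n ℂ} {Y : κ → Matrix n n ℂ}
    (hc : IsOptimalUncertaintyBound lam mu X Y c) :
    ∃ ρ, IsQuantumState ρ ∧ linearUncertainty lam mu X Y ρ = c := by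
  have hne : {ρ : Matrix n n ℂ | IsQuantumState ρ}.Nonempty := by
    -- Without states (`n` empty) every real is vacuously a bound, so none is largest.
    by_contra h
    have hb : IsUncertaintyBound lam mu X Y (c + 1) := fun ρ hρ => (h ⟨ρ, hρ⟩).elim
    linarith [hc.2 hb]
  have hcont : Continuous (linearUncertainty lam mu X Y) :=
    (continuous_const.mul (continuous_measurementEntropy X)).add
      (continuous_const.mul (continuous_measurementEntropy Y))
  obtain ⟨ρ, hρ, hmin⟩ :=
    (isCompact_setOf_isQuantumState n).exists_isMinOn hne hcont.continuousOn
  -- The minimum value is itself a bound, so it cannot exceed `c`.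
  exact ⟨ρ, hρ, le_antisymm (hc.2 fun σ hσ => hmin hσ) (hc.1 ρ hρ)⟩

theorem IsQuantumState.kronecker {a b : Type*} [Fintype a] [Fintype b] {ρA : Matrix a a ℂ}
    {ρB : Matrix b b ℂ} (hA : IsQuantumState ρA) (hB : IsQuantumState ρB) :
    IsQuantumState (ρA ⊗ₖ ρB) :=
  ⟨hA.posSemidef.kronecker hB.posSemidef,
    by rw [Matrix.trace_kronecker, hA.trace_eq_one, hB.trace_eq_one, one_mul]⟩

/-- Entropies of joint measurements add up in product states. -/
theorem measurementEntropy_productMeasurement_kronecker {ι κ a b : Type*} [Fintype ι] [Fintype κ]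
    [Fintype a] [DecidableEq a] [Fintype b] [DecidableEq b] {X : ι → Matrix a a ℂ}
    {X' : κ → Matrix b b ℂ} (hX : IsProjectiveMeasurement X) (hX' : IsProjectiveMeasurement X')
    {ρA : Matrix a a ℂ} {ρB : Matrix b b ℂ} (hA : IsQuantumState ρA) (hB : IsQuantumState ρB) :
    measurementEntropy (productMeasurement X X') (ρA ⊗ₖ ρB) =
      measurementEntropy X ρA + measurementEntropy X' ρB := by
  have hp : ∀ i j, outcomeProb (productMeasurement X X') (ρA ⊗ₖ ρB) (i, j) =
      outcomeProb X ρA i * outcomeProb X' ρB j := by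
    intro i j
    rw [outcomeProb, productMeasurement, ← Matrix.mul_kronecker_mul, Matrix.trace_kronecker,
      ← hX.ofReal_outcomeProb hA.posSemidef, ← hX'.ofReal_outcomeProb hB.posSemidef,
      ← Complex.ofReal_mul, Complex.ofReal_re]
  simp only [measurementEntropy, Fintype.sum_prod_type, hp, Real.negMulLog_mul,
    Finset.sum_add_distrib, ← Finset.sum_mul, ← Finset.mul_sum, hX.sum_outcomeProb,
    hX'.sum_outcomeProb, hA.trace_eq_one, hB.trace_eq_one, Complex.one_re, one_mul]

theorem proposition1 {a b ιA κA ιB κB : Type*}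
    [Fintype a] [DecidableEq a] [Fintype b] [DecidableEq b]
    [Fintype ιA] [Fintype κA] [Fintype ιB] [Fintype κB]
    (XA : ιA → Matrix a a ℂ) (YA : κA → Matrix a a ℂ)
    (XB : ιB → Matrix b b ℂ) (YB : κB → Matrix b b ℂ)
    (hXA : IsProjectiveMeasurement XA) (hYA : IsProjectiveMeasurement YA)
    (hXB : IsProjectiveMeasurement XB) (hYB : IsProjectiveMeasurement YB)
    (lam mu : ℝ) (hlam : 0 ≤ lam) (hmu : 0 ≤ mu) (cA cB : ℝ) :
    (IsUncertaintyBound lam mu XA YA cA → IsUncertaintyBound lam mu XB YB cB →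
      IsUncertaintyBound lam mu (productMeasurement XA XB) (productMeasurement YA YB)
        (cA + cB)) ∧
    (IsOptimalUncertaintyBound lam mu XA YA cA → IsOptimalUncertaintyBound lam mu XB YB cB →
      IsOptimalUncertaintyBound lam mu (productMeasurement XA XB) (productMeasurement YA YB)
        (cA + cB) ∧
      ∃ (ρA : Matrix a a ℂ) (ρB : Matrix b b ℂ), IsQuantumState ρA ∧ IsQuantumState ρB ∧
        linearUncertainty lam mu (productMeasurement XA XB) (productMeasurement YA YB)
          (ρA ⊗ₖ ρB) = cA + cB) := by
  have hadd := IsUncertaintyBound.add_productMeasurement hXA hYA hXB hYB hlam hmu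
    (cA := cA) (cB := cB)
  refine ⟨hadd, fun hA hB => ?_⟩
  obtain ⟨ρA, hρA, hcA⟩ := hA.exists_eq
  obtain ⟨ρB, hρB, hcB⟩ := hB.exists_eq
  have heq : linearUncertainty lam mu (productMeasurement XA XB) (productMeasurement YA YB)
      (ρA ⊗ₖ ρB) = cA + cB := by
    rw [← hcA, ← hcB]
    simp only [linearUncertainty]
    rw [measurementEntropy_productMeasurement_kronecker hXA hXB hρA hρB,
      measurementEntropy_productMeasurement_kronecker hYA hYB hρA hρB]
    ring
  -- Any joint bound, evaluated at the product of the minimizers, is at most `cA + cB`.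
  exact ⟨⟨hadd hA.1 hB.1, fun c hc => heq ▸ hc _ (hρA.kronecker hρB)⟩,
    ρA, ρB, hρA, hρB, heq⟩
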